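/- For a positive integer $d$ let $S^{d-1}$ be the unit sphere of $\mathbb{R}^d$, $\sigma$ its rotation-invariant surface measure (the counting measure on $\{\pm 1\}$ if $d=1$), and $|S^{d-1}|=\sigma(S^{d-1})$. Let $\mathrm{Harm}_l(\mathbb{R}^d)$ be the space of real harmonic polynomials in $x_1,\dots,x_d$ that are homogeneous of degree $l$ (together with $0$). For positive integers $w,t$, a finite non-empty set $X\subset S^{d-1}$ is called a spherical $(w,t)$-design in $S^{d-1}$ if $$\frac{1}{|S^{d-1}|}\int_{S^{d-1}}f(x)\,d\sigma(x)=\frac{1}{|X|}\sum_{x\in X}f(x)$$ for all polynomials $$f\in\bigoplus_{l=1}^{t}\ \bigoplus_{k=0}^{\lfloor l/2\rfloor}(x_1^2+\cdots+x_d^2)^k\,\mathrm{Harm}_{w+l-2k}(\mathbb{R}^d).$$ **Corollary (existence of spherical $(w,t)$-designs).** For all positive integers $w,t,d$ there exists a spherical $(w,t)$-design in $S^{d-1}$. -/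

import Mathlib

open MeasureTheory

noncomputable section

/-- The unit sphere `S^{d-1}` in Euclidean space `ℝ^d`. -/
abbrev UnitSphere (d : ℕ) : Type :=
  Metric.sphere (0 : EuclideanSpace ℝ (Fin d)) 1

/-- The rotation-invariant surface measure `σ` on `S^{d-1}`. -/
def surfaceMeasure (d : ℕ) : Measure (UnitSphere d) :=
  (volume : Measure (EuclideanSpace ℝ (Fin d))).toSphere

/-- The Laplacian `∑ i, ∂²/∂x_i²` on real polynomials in `d` variables. -/
def polyLaplacian (d : ℕ) : MvPolynomial (Fin d) ℝ →ₗ[ℝ] MvPolynomial (Fin d) ℝ :=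
  ∑ i : Fin d, (MvPolynomial.pderiv (R := ℝ) i).toLinearMap ∘ₗ
    (MvPolynomial.pderiv (R := ℝ) i).toLinearMap

/-- `Harm_l(ℝ^d)`: the harmonic polynomials that are homogeneous of degree `l`
(together with `0`). -/
def harm (d l : ℕ) : Submodule ℝ (MvPolynomial (Fin d) ℝ) :=
  MvPolynomial.homogeneousSubmodule (Fin d) ℝ l ⊓ LinearMap.ker (polyLaplacian d)

/-- The polynomial `x_1² + ⋯ + x_d²`. -/
def normSqPoly (d : ℕ) : MvPolynomial (Fin d) ℝ :=
  ∑ i : Fin d, MvPolynomial.X i ^ 2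

/-- The sum over `1 ≤ l ≤ t` and `0 ≤ k ≤ ⌊l/2⌋` of the subspaces
`(x_1² + ⋯ + x_d²)^k Harm_{w+l-2k}(ℝ^d)` of the polynomial ring. -/
def designSpace (w t d : ℕ) : Submodule ℝ (MvPolynomial (Fin d) ℝ) :=
  ⨆ l ∈ Finset.Icc 1 t, ⨆ k ∈ Finset.Icc 0 (l / 2),
    (harm d (w + l - 2 * k)).map (LinearMap.mulLeft ℝ (normSqPoly d ^ k))

/-- The value of a polynomial at a point of the sphere. -/
def evalSphere {d : ℕ} (f : MvPolynomial (Fin d) ℝ) (x : UnitSphere d) : ℝ :=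
  MvPolynomial.eval (fun i => (x : EuclideanSpace ℝ (Fin d)) i) f

/-- A finite non-empty subset `X` of `S^{d-1}` is a spherical `(w,t)`-design if the mean over
the sphere equals the mean over `X` for every polynomial in `designSpace w t d`. -/
def IsSphericalDesign {d : ℕ} (w t : ℕ) (X : Finset (UnitSphere d)) : Prop :=
  X.Nonempty ∧ ∀ f ∈ designSpace w t d,
    ((surfaceMeasure d).real Set.univ)⁻¹ * ∫ x, evalSphere f x ∂(surfaceMeasure d) =
      (X.card : ℝ)⁻¹ * ∑ x ∈ X, evalSphere f x

end

open Filter Topology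

/-! Only the finite dimension of the test space matters. Subtract from each test polynomial its mean
over the sphere, and let the coordinates of `F` be a basis of the resulting functions: a design is a
finite nonempty set of distinct points where `F` sums to zero. A mean-zero continuous function that
is nowhere positive vanishes, so no nonzero functional is nonpositive on the image of `F` (the
hypothesis `hsep`).

For `d ≥ 2`, this yields a zero sum with positive real weights at distinct points, chosen so that
rotating the points moves the sum in every direction. Such a configuration is stable: by the open
mapping form of the implicit function theorem, small rotations compensate small changes of weights
and points. So the weights can be made rational, hence natural after scaling; then each point of
weight `n` is split into `n` distinct nearby points, rotated together (`exists_natural_weights`,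
`exists_finset_of_natural_weights`). For `d = 1` the whole two-point sphere is a design. -/

/-! ### Implicit functions and general position -/

/-- The map `(t, p) ↦ (H (t, p), p)` has surjective derivative, so it is open at the base point.
Only existence of `t` is needed, so the kernel need not be complemented. -/
theorem HasStrictFDerivAt.eventually_exists_eq_zero
    {T P E : Type*} [NormedAddCommGroup T] [NormedSpace ℝ T] [CompleteSpace T]
    [NormedAddCommGroup P] [NormedSpace ℝ P] [CompleteSpace P]
    [NormedAddCommGroup E] [NormedSpace ℝ E] [CompleteSpace E]
    {H : T × P → E} {H' : T × P →L[ℝ] E} {t₀ : T} {p₀ : P}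
    (hH : HasStrictFDerivAt H H' (t₀, p₀)) (h0 : H (t₀, p₀) = 0)
    (hs : ∀ e, ∃ t, H' (t, 0) = e) {Q : T × P → Prop} (hQ : ∀ᶠ z in 𝓝 (t₀, p₀), Q z) :
    ∀ᶠ p in 𝓝 p₀, ∃ t, H (t, p) = 0 ∧ Q (t, p) := by
  have hK := hH.prodMk (hasStrictFDerivAt_snd (𝕜 := ℝ) (p := (t₀, p₀)))
  have hsurj : (H'.prod (ContinuousLinearMap.snd ℝ T P)).range = ⊤ := by
    rw [LinearMap.range_eq_top]
    rintro ⟨e, p⟩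
    obtain ⟨t, ht⟩ := hs (e - H' (0, p))
    refine ⟨(t, p), ?_⟩
    have : ((t, p) : T × P) = (t, 0) + (0, p) := by simp
    ext <;> simp [this, ht, -Prod.mk_add_mk, map_add]
  have hmap := hK.map_nhds_eq_of_surj hsurj
  have h1 : ∀ᶠ w in 𝓝 (H (t₀, p₀), p₀), ∃ z, (H z, z.2) = w ∧ Q z := by
    rw [← hmap, eventually_map]
    exact hQ.mono fun z hz => ⟨z, rfl, hz⟩
  rw [h0] at h1
  have h2 : Tendsto (fun p : P => ((0 : E), p)) (𝓝 p₀) (𝓝 (0, p₀)) :=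
    (Continuous.prodMk_right (0 : E)).tendsto p₀
  filter_upwards [h2.eventually h1] with p hp
  obtain ⟨⟨t, q⟩, hz, hQz⟩ := hp
  simp only [Prod.mk.injEq] at hz
  obtain ⟨hz1, rfl⟩ := hz
  exact ⟨t, hz1, hQz⟩

theorem ContinuousLinearMap.isOpen_surjective {T E : Type*} [NormedAddCommGroup T]
    [NormedSpace ℝ T] [NormedAddCommGroup E] [NormedSpace ℝ E] [FiniteDimensional ℝ E] :
    IsOpen {L : T →L[ℝ] E | Function.Surjective L} := by
  have h : {L : T →L[ℝ] E | Function.Surjective L} =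
      {L : T →L[ℝ] E | (Module.finrank ℝ E : Cardinal) ≤ (L : T →ₗ[ℝ] E).rank} := by
    ext L
    simp only [Set.mem_ofPred_eq]
    rw [LinearMap.rank, ← Module.finrank_eq_rank, Nat.cast_le]
    constructor
    · intro hL
      rw [LinearMap.range_eq_top.2 (by exact hL), finrank_top]
    · intro hL
      have := Submodule.eq_top_of_finrank_eq
        (le_antisymm (Submodule.finrank_le (LinearMap.range (L : T →ₗ[ℝ] E))) hL)
      exact LinearMap.range_eq_top.1 this
  rw [h]
  exact isOpen_setOfPred_nat_le_rank _

/-- Hall's marriage theorem, applied to finite subsets with as many elements as there are indices.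
-/
theorem exists_injective_of_infinite {κ X : Type*} [Finite κ] {U : κ → Set X}
    (hU : ∀ k, (U k).Infinite) : ∃ y : κ → X, Function.Injective y ∧ ∀ k, y k ∈ U k := by
  classical
  have := Fintype.ofFinite κ
  choose t htU htc using fun k => (hU k).exists_subset_card_eq (Fintype.card κ)
  obtain ⟨f, hf, hft⟩ := (Finset.all_card_le_biUnion_card_iff_exists_injective t).1 (by
    intro s
    rcases s.eq_empty_or_nonempty with rfl | ⟨k, hk⟩
    · simp
    · calc s.card ≤ (t k).card := by rw [htc]; exact Finset.card_le_univ s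
        _ ≤ _ := Finset.card_le_card (Finset.subset_biUnion_of_mem t hk))
  exact ⟨f, hf, fun k => htU k (hft k)⟩

theorem exists_injective_of_mem_nhds {κ X : Type*} [Finite κ] [TopologicalSpace X] [T1Space X]
    [PerfectSpace X] {y₀ : κ → X} {P : (κ → X) → Prop} (hP : ∀ᶠ y in 𝓝 y₀, P y) :
    ∃ y : κ → X, Function.Injective y ∧ P y := by
  rw [nhds_pi, Filter.eventually_iff, Filter.mem_pi] at hP
  obtain ⟨I, -, U, hU, hsub⟩ := hP
  obtain ⟨y, hy, hyU⟩ := exists_injective_of_infinite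
    (fun k => infinite_of_mem_nhds (y₀ k) (hU k))
  exact ⟨y, hy, hsub fun k _ => hyU k⟩

/-! ### Rotating the points of a weighted sum -/

section Flow

variable {V E ι κ : Type*} [NormedAddCommGroup V] [InnerProductSpace ℝ V]
  [NormedAddCommGroup E] [NormedSpace ℝ E] [Fintype ι] [Fintype κ]

/-- The time-`s` map of the linear flow generated by `A`. -/
noncomputable def linearFlow (A : V →L[ℝ] V) (s : ℝ) : V →L[ℝ] V :=
  NormedSpace.exp (s • A)

theorem linearFlow_zero (A : V →L[ℝ] V) : linearFlow A 0 = 1 := by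
  simp [linearFlow]

/-- The velocity of `∑ i, β i • F (x i)` when each `x i` moves along the flow of `A i`. -/
noncomputable def flowVelocity (F : V → E) (A : ι → V →L[ℝ] V) (β : ι → ℝ) (x : ι → V) :
    (ι → ℝ) →L[ℝ] E :=
  ∑ i, (ContinuousLinearMap.proj i : (ι → ℝ) →L[ℝ] ℝ).smulRight
    (β i • fderiv ℝ F (x i) (A i (x i)))

theorem flowVelocity_apply (F : V → E) (A : ι → V →L[ℝ] V) (β : ι → ℝ) (x : ι → V)
    (τ : ι → ℝ) :
    flowVelocity F A β x τ = ∑ i, τ i • β i • fderiv ℝ F (x i) (A i (x i)) := by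
  simp [flowVelocity]

theorem isOpen_flowVelocity_surjective [FiniteDimensional ℝ E] {F : V → E} (hF : ContDiff ℝ 1 F)
    (A : ι → V →L[ℝ] V) :
    IsOpen {q : (ι → ℝ) × (ι → V) | Function.Surjective (flowVelocity F A q.1 q.2)} := by
  have hc : Continuous fun q : (ι → ℝ) × (ι → V) => flowVelocity F A q.1 q.2 := by
    refine continuous_finsetSum _ fun i _ => ?_
    have h1 : Continuous fun q : (ι → ℝ) × (ι → V) =>
        q.1 i • fderiv ℝ F (q.2 i) (A i (q.2 i)) := by
      have := hF.continuous_fderiv one_ne_zero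
      fun_prop
    exact (ContinuousLinearMap.smulRightL ℝ (ι → ℝ) E
      (ContinuousLinearMap.proj i)).continuous.comp h1
  exact ContinuousLinearMap.isOpen_surjective.preimage hc

variable [CompleteSpace V]

theorem hasStrictDerivAt_linearFlow_zero (A : V →L[ℝ] V) :
    HasStrictDerivAt (linearFlow A) A 0 := by
  have h := hasStrictDerivAt_exp_smul_const (𝕂 := ℝ) A (0 : ℝ)
  simpa [linearFlow] using! h

theorem linearFlow_mem_unitary {A : V →L[ℝ] V} (hA : A ∈ skewAdjoint (V →L[ℝ] V)) (s : ℝ) :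
    linearFlow A s ∈ unitary (V →L[ℝ] V) :=
  letI := NormedAlgebra.restrictScalars ℚ ℝ (V →L[ℝ] V)
  NormedSpace.exp_mem_unitary_of_mem_skewAdjoint (skewAdjoint.smul_mem s hA)

theorem norm_linearFlow {A : V →L[ℝ] V} (hA : A ∈ skewAdjoint (V →L[ℝ] V)) (s : ℝ) (x : V) :
    ‖linearFlow A s x‖ = ‖x‖ :=
  ContinuousLinearMap.norm_map_of_mem_unitary (linearFlow_mem_unitary hA s) x

theorem linearFlow_injective {A : V →L[ℝ] V} (hA : A ∈ skewAdjoint (V →L[ℝ] V)) (s : ℝ) :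
    Function.Injective (linearFlow A s) := by
  intro x y h
  have : ‖linearFlow A s (x - y)‖ = 0 := by rw [map_sub, h, sub_self, norm_zero]
  rwa [norm_linearFlow hA, norm_sub_eq_zero_iff] at this

theorem continuousAt_linearFlow_zero (A : V →L[ℝ] V) (x : V) :
    ContinuousAt (fun z : ℝ × V => linearFlow A z.1 z.2) (0, x) := by
  have h : ContinuousAt (fun z : ℝ × V => linearFlow A z.1) (0, x) :=
    ContinuousAt.comp (f := Prod.fst) (x := ((0 : ℝ), x))
      (hasStrictDerivAt_linearFlow_zero A).hasDerivAt.continuousAt continuousAt_fst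
  exact h.clm_apply continuousAt_snd

/-- The map `c` groups the points into classes; each class has one time parameter, so its points
move by a common isometry. -/
theorem exists_hasStrictFDerivAt_flow_sum {F : V → E} (hF : ContDiff ℝ 1 F)
    (A : ι → V →L[ℝ] V) (c : κ → ι) (β₀ : κ → ℝ) (y₀ : κ → V) :
    ∃ H' : (ι → ℝ) × ((κ → ℝ) × (κ → V)) →L[ℝ] E,
      HasStrictFDerivAt (fun z : (ι → ℝ) × ((κ → ℝ) × (κ → V)) =>
        ∑ k, z.2.1 k • F (linearFlow (A (c k)) (z.1 (c k)) (z.2.2 k))) H' (0, (β₀, y₀)) ∧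
      ∀ τ, H' (τ, 0) = ∑ k, τ (c k) • β₀ k • fderiv ℝ F (y₀ k) (A (c k) (y₀ k)) := by
  have key : ∀ k, ∃ H' : (ι → ℝ) × ((κ → ℝ) × (κ → V)) →L[ℝ] E,
      HasStrictFDerivAt (fun z : (ι → ℝ) × ((κ → ℝ) × (κ → V)) =>
        z.2.1 k • F (linearFlow (A (c k)) (z.1 (c k)) (z.2.2 k))) H' (0, (β₀, y₀)) ∧
      ∀ τ, H' (τ, 0) = τ (c k) • β₀ k • fderiv ℝ F (y₀ k) (A (c k) (y₀ k)) := by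
    intro k
    let z₀ : (ι → ℝ) × ((κ → ℝ) × (κ → V)) := (0, (β₀, y₀))
    let pτ : (ι → ℝ) × ((κ → ℝ) × (κ → V)) →L[ℝ] ℝ :=
      (ContinuousLinearMap.proj (c k)).comp (ContinuousLinearMap.fst ℝ _ _)
    let pβ : (ι → ℝ) × ((κ → ℝ) × (κ → V)) →L[ℝ] ℝ :=
      (ContinuousLinearMap.proj k).comp
        ((ContinuousLinearMap.fst ℝ _ _).comp (ContinuousLinearMap.snd ℝ _ _))
    let py : (ι → ℝ) × ((κ → ℝ) × (κ → V)) →L[ℝ] V :=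
      (ContinuousLinearMap.proj k).comp
        ((ContinuousLinearMap.snd ℝ _ _).comp (ContinuousLinearMap.snd ℝ _ _))
    have hexp := (hasStrictDerivAt_linearFlow_zero (A (c k))).hasStrictFDerivAt.comp
      (f := pτ) z₀ pτ.hasStrictFDerivAt
    have happ := hexp.clm_apply (py.hasStrictFDerivAt (x := z₀))
    have hFk := (hF.contDiffAt (x := y₀ k)).hasStrictFDerivAt (by simp)
    have heq : (linearFlow (A (c k)) ∘ pτ) z₀ (py z₀) = y₀ k := by
      simp [z₀, pτ, py, linearFlow_zero]
    rw [← heq] at hFk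
    have hcomp := hFk.comp z₀ happ
    have hsm := (pβ.hasStrictFDerivAt (x := z₀)).smul hcomp
    refine ⟨_, hsm, fun τ => ?_⟩
    rw [heq]
    simp [z₀, pτ, pβ, py, linearFlow_zero, smul_smul, mul_comm]
  choose H' h1 h2 using key
  refine ⟨∑ k, H' k, HasStrictFDerivAt.fun_sum fun k _ => h1 k, fun τ => ?_⟩
  simp [h2]

theorem eventually_exists_flow_sum_eq_zero [CompleteSpace E] {F : V → E} (hF : ContDiff ℝ 1 F)
    (A : ι → V →L[ℝ] V) (c : κ → ι) {β₀ : κ → ℝ} {y₀ : κ → V}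
    (h0 : ∑ k, β₀ k • F (y₀ k) = 0)
    (hs : ∀ e, ∃ τ : ι → ℝ,
      ∑ k, τ (c k) • β₀ k • fderiv ℝ F (y₀ k) (A (c k) (y₀ k)) = e)
    {Q : (κ → ℝ) → (κ → V) → Prop}
    (hQ : ∀ᶠ q : (κ → ℝ) × (κ → V) in 𝓝 (β₀, y₀), Q q.1 q.2) :
    ∀ᶠ p : (κ → ℝ) × (κ → V) in 𝓝 (β₀, y₀), ∃ τ : ι → ℝ,
      ∑ k, p.1 k • F (linearFlow (A (c k)) (τ (c k)) (p.2 k)) = 0 ∧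
      Q p.1 (fun k => linearFlow (A (c k)) (τ (c k)) (p.2 k)) := by
  obtain ⟨H', h1, h2⟩ := exists_hasStrictFDerivAt_flow_sum hF A c β₀ y₀
  have hcont : Tendsto (fun z : (ι → ℝ) × ((κ → ℝ) × (κ → V)) =>
      (z.2.1, fun k => linearFlow (A (c k)) (z.1 (c k)) (z.2.2 k))) (𝓝 (0, (β₀, y₀)))
      (𝓝 (β₀, y₀)) := by
    refine Tendsto.prodMk_nhds
      ((continuous_fst.comp continuous_snd).tendsto (0, (β₀, y₀)))
      (tendsto_pi_nhds.2 fun k => ?_)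
    have hc := (continuousAt_linearFlow_zero (A (c k)) (y₀ k)).tendsto
    simp only [linearFlow_zero, one_apply_eq_self] at hc
    have hz : Tendsto (fun z : (ι → ℝ) × ((κ → ℝ) × (κ → V)) => (z.1 (c k), z.2.2 k))
        (𝓝 (0, (β₀, y₀))) (𝓝 (0, y₀ k)) :=
      Continuous.tendsto' (by fun_prop) _ _ (by simp)
    exact hc.comp hz
  exact h1.eventually_exists_eq_zero (by simpa [linearFlow_zero] using h0)
    (fun e => by simpa only [h2] using hs e) (hcont.eventually hQ)

end Flow

/-! ### From real weights to natural weights to distinct points -/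

section Perturbation

variable {V E ι : Type*} [NormedAddCommGroup V] [InnerProductSpace ℝ V] [CompleteSpace V]
  [NormedAddCommGroup E] [NormedSpace ℝ E] [CompleteSpace E] [Fintype ι]

theorem eventually_forall_ne_of_ne {κ X : Type*} [Finite κ] [TopologicalSpace X] [T2Space X]
    {y₀ : κ → X} {r : κ → κ → Prop} (h : ∀ k l, r k l → y₀ k ≠ y₀ l) :
    ∀ᶠ y in 𝓝 y₀, ∀ k l, r k l → y k ≠ y l := by
  simp only [eventually_all]
  intro k l hkl
  exact (isOpen_ne_fun (continuous_apply k) (continuous_apply l)).mem_nhds (h k l hkl)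

theorem tendsto_natFloor_mul_div {κ : Type*} (α : κ → ℝ) (hα : ∀ i, 0 < α i) :
    Tendsto (fun (N : ℕ) (i : κ) => (⌊α i * N⌋₊ : ℝ) / N) atTop (𝓝 α) :=
  tendsto_pi_nhds.2 fun i =>
    (tendsto_nat_floor_mul_div_atTop (hα i).le).comp tendsto_natCast_atTop_atTop

/-- Real weights in a balanced configuration that can be moved in all directions can be replaced
by natural numbers. -/
theorem exists_natural_weights [FiniteDimensional ℝ E] {F : V → E} (hF : ContDiff ℝ 1 F) {A : ι → V →L[ℝ] V}
    (hA : ∀ i, A i ∈ skewAdjoint (V →L[ℝ] V)) {x : ι → V} (hx : Function.Injective x)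
    (hx1 : ∀ i, ‖x i‖ = 1) {α : ι → ℝ} (hα : ∀ i, 0 < α i) (h0 : ∑ i, α i • F (x i) = 0)
    (hs : Function.Surjective (flowVelocity F A α x)) :
    ∃ (n : ι → ℕ) (x' : ι → V), (∀ i, 0 < n i) ∧ Function.Injective x' ∧ (∀ i, ‖x' i‖ = 1) ∧
      ∑ i, (n i : ℝ) • F (x' i) = 0 ∧
      Function.Surjective (flowVelocity F A (fun i => (n i : ℝ)) x') := by
  have hQ : ∀ᶠ q : (ι → ℝ) × (ι → V) in 𝓝 (α, x),
      Function.Surjective (flowVelocity F A q.1 q.2) ∧ ∀ i j, i ≠ j → q.2 i ≠ q.2 j :=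
    Filter.Eventually.and ((isOpen_flowVelocity_surjective hF A).mem_nhds
      (show (α, x) ∈ {q : (ι → ℝ) × (ι → V) | _} from hs))
      ((continuous_snd.tendsto (α, x)).eventually
        (eventually_forall_ne_of_ne fun i j hij => hx.ne hij))
  have h1 := eventually_exists_flow_sum_eq_zero hF A id h0
    (fun e => (hs e).imp fun τ h => by rw [flowVelocity_apply] at h; exact h)
    (Q := fun β y => Function.Surjective (flowVelocity F A β y) ∧ ∀ i j, i ≠ j → y i ≠ y j) hQ
  -- The weights `⌊α i * N⌋₊ / N` tend to `α i`; the rotations absorb the error, and multiplying by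
  -- `N` makes the weights natural.
  have hlim : Tendsto (fun N : ℕ => ((fun i => (⌊α i * N⌋₊ : ℝ) / N : ι → ℝ), x)) atTop
      (𝓝 (α, x)) := (tendsto_natFloor_mul_div α hα).prodMk_nhds tendsto_const_nhds
  have hpos : ∀ᶠ N : ℕ in atTop, ∀ i, 0 < (⌊α i * N⌋₊ : ℝ) / N :=
    eventually_all.2 fun i => ((tendsto_pi_nhds.1 (tendsto_natFloor_mul_div α hα)) i).eventually
      (lt_mem_nhds (hα i))
  obtain ⟨N, ⟨τ, hτ, hsurj, hne⟩, hN, hN0⟩ :=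
    ((hlim.eventually h1).and (hpos.and (eventually_gt_atTop 0))).exists
  have hN0' : (0 : ℝ) < N := by exact_mod_cast hN0
  have hmul : ∀ (i : ι) (v : E),
      (⌊α i * N⌋₊ : ℝ) • v = (N : ℝ) • ((⌊α i * N⌋₊ : ℝ) / N) • v := fun i v => by
    rw [smul_smul, mul_div_cancel₀ _ hN0'.ne']
  refine ⟨fun i => ⌊α i * N⌋₊, fun i => linearFlow (A i) (τ i) (x i), fun i => ?_,
    fun i j hij => ?_, fun i => by rw [norm_linearFlow (hA i), hx1], ?_, fun e => ?_⟩
  · have := (div_pos_iff_of_pos_right hN0').1 (hN i)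
    exact_mod_cast this
  · by_contra hij'
    exact hne i j hij' hij
  · simp only [hmul, ← Finset.smul_sum]
    simp only [id] at hτ
    rw [hτ, smul_zero]
  · obtain ⟨σ, hσ⟩ := hsurj ((N : ℝ)⁻¹ • e)
    refine ⟨σ, ?_⟩
    rw [flowVelocity_apply] at hσ ⊢
    simp only [hmul, smul_comm _ (N : ℝ), ← Finset.smul_sum]
    simp only [id] at hσ
    rw [hσ, smul_inv_smul₀ hN0'.ne']

/-- Natural weights in a balanced configuration that can be moved in all directions can be
realized by distinct points. -/
theorem exists_finset_of_natural_weights [PerfectSpace (Metric.sphere (0 : V) 1)] [Nonempty ι]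
    {F : V → E} (hF : ContDiff ℝ 1 F) {A : ι → V →L[ℝ] V}
    (hA : ∀ i, A i ∈ skewAdjoint (V →L[ℝ] V)) {n : ι → ℕ} (hn : ∀ i, 0 < n i) {x : ι → V}
    (hx : Function.Injective x) (hx1 : ∀ i, ‖x i‖ = 1) (h0 : ∑ i, (n i : ℝ) • F (x i) = 0)
    (hs : Function.Surjective (flowVelocity F A (fun i => (n i : ℝ)) x)) :
    ∃ X : Finset (Metric.sphere (0 : V) 1), X.Nonempty ∧ ∑ x ∈ X, F x = 0 := by
  classical
  -- Each `x i` becomes `n i` copies of weight one, forming one class of `c`.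
  let κ := Σ i, Fin (n i)
  let c : κ → ι := Sigma.fst
  let s₀ : κ → Metric.sphere (0 : V) 1 := fun k => ⟨x k.1, by simp [hx1]⟩
  have h0' : ∑ k : κ, (1 : κ → ℝ) k • F (x (c k)) = 0 := by
    simpa [Fintype.sum_sigma, κ, c, Nat.cast_smul_eq_nsmul] using h0
  have hs' : ∀ e, ∃ τ : ι → ℝ, ∑ k : κ, τ (c k) • (1 : κ → ℝ) k •
      fderiv ℝ F (x (c k)) (A (c k) (x (c k))) = e := fun e => by
    obtain ⟨τ, hτ⟩ := hs e
    refine ⟨τ, ?_⟩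
    rw [← hτ, flowVelocity_apply]
    simp only [κ, c, Fintype.sum_sigma, Finset.sum_const, Finset.card_univ, Fintype.card_fin,
      Pi.one_apply, one_smul]
    refine Finset.sum_congr rfl fun i _ => ?_
    rw [smul_comm (τ i), Nat.cast_smul_eq_nsmul]
  have h1 := eventually_exists_flow_sum_eq_zero hF A c h0' hs'
    (Q := fun _ y => ∀ k l, c k ≠ c l → y k ≠ y l)
    ((continuous_snd.tendsto ((1 : κ → ℝ), fun k => x (c k))).eventually
      (eventually_forall_ne_of_ne fun k l hkl => hx.ne hkl))
  have hlim : Tendsto (fun s : κ → Metric.sphere (0 : V) 1 =>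
      ((1 : κ → ℝ), fun k => (s k : V))) (𝓝 s₀) (𝓝 (1, fun k => x (c k))) :=
    Continuous.tendsto (by fun_prop) s₀
  obtain ⟨y, hy, τ, hτ, hne⟩ := exists_injective_of_mem_nhds (hlim.eventually h1)
  let g : κ → Metric.sphere (0 : V) 1 := fun k => ⟨linearFlow (A (c k)) (τ (c k)) (y k), by
    simp [norm_linearFlow (hA (c k))]⟩
  have hg : Function.Injective g := fun k l hkl => by
    have hkl' : linearFlow (A (c k)) (τ (c k)) (y k) = linearFlow (A (c l)) (τ (c l)) (y l) :=
      congrArg Subtype.val hkl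
    -- Within a class a common injective map keeps points distinct; different classes stay apart
    -- because their centres differ.
    by_cases hc : c k = c l
    · rw [hc] at hkl'
      exact hy (Subtype.ext (linearFlow_injective (hA (c l)) _ hkl'))
    · exact absurd hkl' (hne k l hc)
  have : Nonempty κ := ‹Nonempty ι›.map fun i => ⟨i, ⟨0, hn i⟩⟩
  refine ⟨Finset.univ.image g, Finset.univ_nonempty.image g, ?_⟩
  rw [Finset.sum_image hg.injOn]
  simpa [g] using hτ

end Perturbation

/-! ### Balanced configurations on the sphere -/

section Sphere

variable {V E : Type*} [NormedAddCommGroup V] [InnerProductSpace ℝ V] [CompleteSpace V]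
  [NormedAddCommGroup E] [NormedSpace ℝ E]

theorem perfectSpace_sphere {V : Type*} [NormedAddCommGroup V] [NormedSpace ℝ V]
    (h : 1 < Module.rank ℝ V) : PerfectSpace (Metric.sphere (0 : V) 1) := by
  have : ConnectedSpace (Metric.sphere (0 : V) 1) :=
    isConnected_iff_connectedSpace.1 (isConnected_sphere h 0 zero_le_one)
  obtain ⟨x⟩ : Nonempty (Metric.sphere (0 : V) 1) := inferInstance
  have : Nontrivial (Metric.sphere (0 : V) 1) :=
    ⟨x, -x, fun hx => ne_neg_of_mem_unit_sphere ℝ x hx⟩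
  infer_instance

/-- The infinitesimal rotation in the plane spanned by `u` and `v`. -/
noncomputable def infinitesimalRotation (u v : V) : V →L[ℝ] V :=
  (innerSL ℝ u).smulRight v - (innerSL ℝ v).smulRight u

theorem infinitesimalRotation_mem_skewAdjoint (u v : V) :
    infinitesimalRotation u v ∈ skewAdjoint (V →L[ℝ] V) := by
  rw [skewAdjoint.mem_iff, ContinuousLinearMap.star_eq_adjoint, eq_comm,
    ContinuousLinearMap.eq_adjoint_iff]
  intro x y
  simp [infinitesimalRotation, inner_sub_left, inner_sub_right, inner_smul_left,
    inner_smul_right, real_inner_comm]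
  ring

theorem exists_orthonormal_pair_of_mem_sphere {V : Type*} [NormedAddCommGroup V]
    [InnerProductSpace ℝ V] {x y : V} (hx : ‖x‖ = 1) (hy : ‖y‖ = 1)
    (hxy : y ≠ x) (hxy' : y ≠ -x) :
    ∃ (v : V) (θ : ℝ), ‖v‖ = 1 ∧ inner ℝ x v = 0 ∧ y = Real.cos θ • x + Real.sin θ • v := by
  set a : ℝ := inner ℝ x y with ha
  set w : V := y - a • x with hw
  have hxw : inner ℝ x w = 0 := by
    simp [hw, inner_sub_right, inner_smul_right, hx, ha]
  have hww : ‖w‖ ^ 2 = 1 - a ^ 2 := by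
    rw [hw, norm_sub_sq_real, inner_smul_right, real_inner_comm, ← ha, norm_smul, hx, hy,
      Real.norm_eq_abs, mul_one, sq_abs]
    ring
  have hw0 : w ≠ 0 := by
    intro h
    have ha2 : a ^ 2 = 1 := by rw [h] at hww; simp at hww; linarith
    rw [hw, sub_eq_zero] at h
    rcases (sq_eq_sq_iff_eq_or_eq_neg.1 (ha2.trans (one_pow 2).symm)) with h1 | h1
    · exact hxy (by rw [h, h1, one_smul])
    · exact hxy' (by rw [h, h1, neg_one_smul])
  have hwpos : 0 < ‖w‖ := norm_pos_iff.2 hw0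
  have hle : |a| ≤ 1 := (sq_le_one_iff_abs_le_one a).1 (by nlinarith [sq_nonneg ‖w‖])
  refine ⟨‖w‖⁻¹ • w, Real.arccos a, ?_, ?_, ?_⟩
  · rw [norm_smul, norm_inv, norm_norm, inv_mul_cancel₀ hwpos.ne']
  · rw [inner_smul_right, hxw, mul_zero]
  · rw [Real.cos_arccos (abs_le.1 hle).1 (abs_le.1 hle).2, Real.sin_arccos, ← hww,
      Real.sqrt_sq hwpos.le, smul_inv_smul₀ hwpos.ne', hw]
    abel

/-- A function with vanishing derivative along all infinitesimal rotations is constant on the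
unit sphere. -/
theorem eq_on_sphere_of_fderiv_skewAdjoint_eq_zero [PerfectSpace (Metric.sphere (0 : V) 1)]
    {g : V → ℝ} (hg : Differentiable ℝ g)
    (h : ∀ x : V, ‖x‖ = 1 → ∀ A ∈ skewAdjoint (V →L[ℝ] V), fderiv ℝ g x (A x) = 0)
    {x y : V} (hx : ‖x‖ = 1) (hy : ‖y‖ = 1) : g x = g y := by
  have key : ∀ x y : V, ‖x‖ = 1 → ‖y‖ = 1 → y ≠ -x → g x = g y := by
    intro x y hx hy hxy'
    by_cases hxy : y = x
    · rw [hxy]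
    obtain ⟨v, θ, hv, hxv, rfl⟩ := exists_orthonormal_pair_of_mem_sphere hx hy hxy hxy'
    let γ : ℝ → V := fun s => Real.cos s • x + Real.sin s • v
    have hγ : ∀ s, HasDerivAt γ (-Real.sin s • x + Real.cos s • v) s := fun s =>
      ((Real.hasDerivAt_cos s).smul_const x).add ((Real.hasDerivAt_sin s).smul_const v)
    have hvx : inner ℝ v x = 0 := by rw [real_inner_comm, hxv]
    have hnorm : ∀ s, ‖γ s‖ = 1 := fun s => by
      have : ‖γ s‖ ^ 2 = 1 := by
        simp [γ, norm_add_sq_real, norm_smul, inner_smul_left, inner_smul_right, hxv, hx, hv]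
      exact (sq_eq_sq₀ (norm_nonneg _) zero_le_one).1 (this.trans (one_pow 2).symm)
    have hA : ∀ s, infinitesimalRotation x v (γ s) = -Real.sin s • x + Real.cos s • v := by
      intro s
      simp [infinitesimalRotation, γ, inner_add_right, inner_smul_right, hxv, hvx, hx, hv]
      abel
    have hd : ∀ s, HasDerivAt (g ∘ γ) 0 s := fun s => by
      have := (hg (γ s)).hasFDerivAt.comp_hasDerivAt s (hγ s)
      rwa [← hA, h _ (hnorm s) _ (infinitesimalRotation_mem_skewAdjoint x v)] at this
    have := is_const_of_deriv_eq_zero (fun s => (hd s).differentiableAt)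
      (fun s => (hd s).deriv) 0 θ
    simpa [γ] using this
  -- Antipodes do not determine a great circle, so pass through a third point.
  by_cases hxy : y = -x
  · have hinf : (Set.univ : Set (Metric.sphere (0 : V) 1)).Infinite :=
      infinite_of_mem_nhds ⟨x, by simpa using hx⟩ univ_mem
    classical
    obtain ⟨z, -, hz⟩ := hinf.exists_notMem_finset
      {⟨x, by simpa using hx⟩, ⟨-x, by simpa using hx⟩}
    simp only [Finset.mem_insert, Finset.mem_singleton, not_or, Subtype.ext_iff] at hz
    have hz1 : ‖(z : V)‖ = 1 := by simp
    rw [key x z hx hz1 hz.2, key z y hz1 hy (by rw [hxy]; exact fun h => hz.1 (neg_inj.1 h).symm)]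
  · exact key x y hx hy hxy

variable [FiniteDimensional ℝ E]

/-- A functional killing all these derivatives would be constant along `F` on the sphere, so it or
its negative would violate `hsep`. -/
theorem span_fderiv_skewAdjoint_eq_top [PerfectSpace (Metric.sphere (0 : V) 1)]
    {F : V → E} (hF : ContDiff ℝ 1 F)
    (hsep : ∀ l : E →L[ℝ] ℝ, (∀ x : Metric.sphere (0 : V) 1, l (F x) ≤ 0) → l = 0) :
    Submodule.span ℝ {e : E | ∃ (x : Metric.sphere (0 : V) 1) (A : V →L[ℝ] V),
      A ∈ skewAdjoint (V →L[ℝ] V) ∧ fderiv ℝ F x (A x) = e} = ⊤ := by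
  by_contra hne
  obtain ⟨f, hf0, hf⟩ := Submodule.exists_le_ker_of_lt_top _ (lt_top_iff_ne_top.2 hne)
  let l : E →L[ℝ] ℝ := f.toContinuousLinearMap
  have hl0 : l ≠ 0 := fun h => hf0 (by ext e; exact congrArg (fun m : E →L[ℝ] ℝ => m e) h)
  have hFd : Differentiable ℝ F := hF.differentiable one_ne_zero
  have hconst : ∀ x y : Metric.sphere (0 : V) 1, l (F x) = l (F y) := fun x y =>
    eq_on_sphere_of_fderiv_skewAdjoint_eq_zero (g := fun x => l (F x))
      (l.differentiable.comp hFd) (fun x hx A hA => by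
        have hd := (l.hasFDerivAt (x := F x)).comp x (hFd x).hasFDerivAt
        rw [show (fun x => l (F x)) = l ∘ F from rfl, hd.fderiv]
        exact hf (Submodule.subset_span ⟨⟨x, by simpa using hx⟩, A, hA, rfl⟩))
      (by simp) (by simp)
  rcases isEmpty_or_nonempty (Metric.sphere (0 : V) 1) with hS | ⟨⟨x₀⟩⟩
  · exact hl0 (hsep l fun x => isEmptyElim x)
  rcases le_total (l (F x₀)) 0 with h | h
  · exact hl0 (hsep l fun x => (hconst x x₀).trans_le h)
  · exact hl0 (neg_eq_zero.1 (hsep (-l) fun x => by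
      rw [neg_apply, hconst x x₀]; linarith))

/-- Otherwise a hyperplane would separate zero from the hull, against `hsep`. Deleting the finite
set `T` is harmless because its complement is dense; it lets later points avoid those already
chosen. -/
theorem zero_mem_interior_convexHull {V : Type*} [NormedAddCommGroup V] [PerfectSpace (Metric.sphere (0 : V) 1)]
    [Nonempty (Metric.sphere (0 : V) 1)] {F : V → E} (hF : Continuous F)
    (hsep : ∀ l : E →L[ℝ] ℝ, (∀ x : Metric.sphere (0 : V) 1, l (F x) ≤ 0) → l = 0)
    {T : Set (Metric.sphere (0 : V) 1)} (hT : T.Finite) :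
    (0 : E) ∈ interior (convexHull ℝ ((fun x : Metric.sphere (0 : V) 1 => F x) '' Tᶜ)) := by
  set s := (fun x : Metric.sphere (0 : V) 1 => F x) '' Tᶜ with hs
  have hdense : Dense Tᶜ := by
    simpa [Set.compl_eq_univ_sdiff] using! dense_univ.sdiff_finite hT
  have hsep' : ∀ l : E →L[ℝ] ℝ, (∀ e ∈ s, l e ≤ 0) → l = 0 := by
    intro l hl
    refine hsep l fun x => ?_
    have hclosed : IsClosed {x : Metric.sphere (0 : V) 1 | l (F x) ≤ 0} :=
      isClosed_le (by fun_prop) continuous_const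
    exact hclosed.closure_subset_iff.2 (fun x hx => hl _ ⟨x, hx, rfl⟩) (hdense x)
  have hsne : s.Nonempty := hdense.nonempty.image _
  obtain ⟨p, hp⟩ := hsne
  have hint : (interior (convexHull ℝ s)).Nonempty := by
    rw [interior_convexHull_nonempty_iff_affineSpan_eq_top]
    by_contra hne
    rw [← AffineSubspace.direction_eq_top_iff_of_nonempty
      ((affineSpan_nonempty (k := ℝ) (s := s)).2 ⟨p, hp⟩), direction_affineSpan] at hne
    obtain ⟨f, hf0, hf⟩ := Submodule.exists_le_ker_of_lt_top _ (lt_top_iff_ne_top.2 hne)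
    let l : E →L[ℝ] ℝ := f.toContinuousLinearMap
    have hl0 : l ≠ 0 := fun h => hf0 (by ext e; exact congrArg (fun m : E →L[ℝ] ℝ => m e) h)
    have hconst : ∀ e ∈ s, l e = l p := fun e he => by
      have : f (e - p) = 0 := hf (vsub_mem_vectorSpan ℝ he hp)
      rw [map_sub, sub_eq_zero] at this
      exact this
    rcases le_total (l p) 0 with h | h
    · exact hl0 (hsep' l fun e he => (hconst e he).trans_le h)
    · exact hl0 (neg_eq_zero.1 (hsep' (-l) fun e he => by
        rw [neg_apply, hconst e he]; linarith))
  by_contra h0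
  obtain ⟨l, hl⟩ := geometric_hahn_banach_open_point (convex_convexHull ℝ s).interior
    isOpen_interior h0
  rw [map_zero] at hl
  have hle : ∀ e ∈ s, l e ≤ 0 := fun e he => by
    have hcl : IsClosed {e : E | l e ≤ 0} := isClosed_le l.continuous continuous_const
    have hmem : e ∈ closure (interior (convexHull ℝ s)) := by
      rw [(convex_convexHull ℝ s).closure_interior_eq_closure_of_nonempty_interior hint]
      exact subset_closure (subset_convexHull ℝ s he)
    exact hcl.closure_subset_iff.2 (fun a ha => (hl a ha).le) hmem
  obtain ⟨a, ha⟩ := hint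
  have := hl a ha
  rw [hsep' l hle] at this
  simp at this

/-- A continuously differentiable map on the unit sphere that is not confined to any closed half
space has finitely many values at distinct points with sum zero. -/
theorem exists_finset_sphere_sum_eq_zero [PerfectSpace (Metric.sphere (0 : V) 1)]
    [Nonempty (Metric.sphere (0 : V) 1)] {F : V → E} (hF : ContDiff ℝ 1 F)
    (hsep : ∀ l : E →L[ℝ] ℝ, (∀ x : Metric.sphere (0 : V) 1, l (F x) ≤ 0) → l = 0) :
    ∃ X : Finset (Metric.sphere (0 : V) 1), X.Nonempty ∧ ∑ x ∈ X, F x = 0 := by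
  have : CompleteSpace E := FiniteDimensional.complete ℝ E
  have hspan := span_fderiv_skewAdjoint_eq_top hF hsep
  obtain ⟨p, f, hf, hfspan⟩ : ∃ (p : ℕ) (f : Fin p → E),
      (∀ i, ∃ (x : Metric.sphere (0 : V) 1) (A : V →L[ℝ] V),
        A ∈ skewAdjoint (V →L[ℝ] V) ∧ fderiv ℝ F x (A x) = f i) ∧
      Submodule.span ℝ (Set.range f) = ⊤ := by
    obtain ⟨f, hf, hfspan, -⟩ := Submodule.exists_fun_fin_finrank_span_eq ℝ
      {e : E | ∃ (x : Metric.sphere (0 : V) 1) (A : V →L[ℝ] V),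
        A ∈ skewAdjoint (V →L[ℝ] V) ∧ fderiv ℝ F x (A x) = e}
    exact ⟨_, f, hf, hfspan.trans hspan⟩
  choose x₀ A hA hxA using hf
  have hs₀ : Function.Surjective (flowVelocity F A 1 fun i => (x₀ i : V)) := by
    intro e
    have he : e ∈ Submodule.span ℝ (Set.range f) := by rw [hfspan]; trivial
    obtain ⟨τ, hτ⟩ := (Submodule.mem_span_range_iff_exists_fun ℝ).1 he
    refine ⟨τ, ?_⟩
    rw [flowVelocity_apply, ← hτ]
    simp [hxA]
  -- The base points `x₀ i` may coincide; surjectivity is an open condition, so they can be made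
  -- distinct.
  have hev : ∀ᶠ y : Fin p → Metric.sphere (0 : V) 1 in 𝓝 x₀,
      Function.Surjective (flowVelocity F A 1 fun i => (y i : V)) := by
    have hlim : Continuous (fun y : Fin p → Metric.sphere (0 : V) 1 =>
        ((1 : Fin p → ℝ), fun i => (y i : V))) := by fun_prop
    exact ((isOpen_flowVelocity_surjective hF A).preimage hlim).mem_nhds hs₀
  obtain ⟨y, hy, hsy⟩ := exists_injective_of_mem_nhds hev
  have h0 := zero_mem_interior_convexHull hF.continuous hsep (Set.finite_range y)
  -- Give each `y i` a small weight `δ`. The opposite of their contribution then lies in the hull of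
  -- values at other points, which balance the sum.
  have hlim : Tendsto (fun δ : ℝ => -(δ • ∑ i, F (y i))) (𝓝[>] 0) (𝓝 0) :=
    (Continuous.tendsto' (by fun_prop) _ _ (by simp)).mono_left nhdsWithin_le_nhds
  obtain ⟨δ, hδmem, hδ⟩ := ((hlim.eventually (mem_interior_iff_mem_nhds.1 h0)).and
    self_mem_nhdsWithin).exists
  have hδ : 0 < δ := hδ
  obtain ⟨J, _, z, w, hz, hzind, hw, hw1, hsum⟩ := eq_pos_convex_span_of_mem_convexHull hδmem
  choose u huT huz using fun j => hz (Set.mem_range_self j)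
  simp only at huz
  have huinj : Function.Injective u := fun j k hjk => hzind.injective (by
    rw [← huz j, ← huz k, hjk])
  have hJ : Nonempty J := by
    by_contra hJ
    rw [not_nonempty_iff] at hJ
    simp at hw1
  let x : Fin p ⊕ J → V := Sum.elim (fun i => (y i : V)) (fun j => (u j : V))
  let α : Fin p ⊕ J → ℝ := Sum.elim (fun _ => δ) w
  -- The balancing points stay fixed: moving the `y i` already gives every direction.
  let B : Fin p ⊕ J → V →L[ℝ] V := Sum.elim A 0
  have hB : ∀ i, B i ∈ skewAdjoint (V →L[ℝ] V) := by
    rintro (i | j)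
    · exact hA i
    · exact zero_mem _
  have hx : Function.Injective x := by
    refine (Subtype.val_injective.comp hy).sumElim (Subtype.val_injective.comp huinj) ?_
    exact fun i j hij => huT j ⟨i, Subtype.ext hij⟩
  have hx1 : ∀ i, ‖x i‖ = 1 := by rintro (i | j) <;> simp [x]
  have hα : ∀ i, 0 < α i := by rintro (i | j) <;> simp [α, hδ, hw]
  have hbal : ∑ i, α i • F (x i) = 0 := by
    simp only [Fintype.sum_sum_type, α, x, Sum.elim_inl, Sum.elim_inr, huz, hsum,
      ← Finset.smul_sum]
    exact add_neg_cancel _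
  have hsurj : Function.Surjective (flowVelocity F B α x) := by
    intro e
    obtain ⟨σ, hσ⟩ := hsy (δ⁻¹ • e)
    refine ⟨Sum.elim σ 0, ?_⟩
    rw [flowVelocity_apply] at hσ ⊢
    simp only [Pi.one_apply, one_smul] at hσ
    simp only [Fintype.sum_sum_type, α, x, B, Sum.elim_inl, Sum.elim_inr, Pi.zero_apply,
      zero_smul, Finset.sum_const_zero, add_zero, smul_comm _ δ, ← Finset.smul_sum, hσ]
    exact smul_inv_smul₀ hδ.ne' e
  obtain ⟨n, x', hn, hx', hx1', hbal', hsurj'⟩ :=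
    exists_natural_weights hF hB hx hx1 hα hbal hsurj
  exact exists_finset_of_natural_weights hF hB hn hx' hx1' hbal' hsurj'

end Sphere

/-! ### Polynomials and their means on the sphere -/

theorem finiteDimensional_designSpace (w t d : ℕ) : FiniteDimensional ℝ (designSpace w t d) := by
  have hharm : ∀ l, FiniteDimensional ℝ (harm d l) := fun l =>
    have : Module.Finite ℝ (MvPolynomial.homogeneousSubmodule (Fin d) ℝ l) :=
      Module.Finite.iff_fg.2 (MvPolynomial.homogeneousSubmodule_fg (Fin d) ℝ l)
    Submodule.finiteDimensional_of_le inf_le_left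
  have h2 : ∀ l, FiniteDimensional ℝ (⨆ k ∈ Finset.Icc 0 (l / 2),
      (harm d (w + l - 2 * k)).map (LinearMap.mulLeft ℝ (normSqPoly d ^ k)) :
      Submodule ℝ (MvPolynomial (Fin d) ℝ)) := fun l => by
    rw [← Finset.sup_eq_iSup]
    infer_instance
  unfold designSpace
  rw [← Finset.sup_eq_iSup]
  infer_instance

theorem continuous_evalSphere {d : ℕ} (f : MvPolynomial (Fin d) ℝ) :
    Continuous (fun x : UnitSphere d => evalSphere f x) :=
  (MvPolynomial.continuous_eval f).comp (by fun_prop)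

theorem contDiff_eval {d : ℕ} (f : MvPolynomial (Fin d) ℝ) :
    ContDiff ℝ 1 (fun x : EuclideanSpace ℝ (Fin d) => MvPolynomial.eval (fun i => x i) f) := by
  induction f using MvPolynomial.induction_on with
  | C a => simpa using contDiff_const
  | add p q hp hq => simpa using hp.add hq
  | mul_X p i hp => simpa using hp.mul (by fun_prop)

instance (d : ℕ) : IsFiniteMeasure (surfaceMeasure d) := by
  unfold surfaceMeasure; infer_instance

instance (d : ℕ) : (surfaceMeasure d).IsOpenPosMeasure := by
  unfold surfaceMeasure; infer_instance

/-- The mean of a polynomial over the sphere. -/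
noncomputable def sphereMean {d : ℕ} (f : MvPolynomial (Fin d) ℝ) : ℝ :=
  ((surfaceMeasure d).real Set.univ)⁻¹ * ∫ x, evalSphere f x ∂(surfaceMeasure d)

theorem integrable_evalSphere {d : ℕ} (f : MvPolynomial (Fin d) ℝ) :
    Integrable (fun x : UnitSphere d => evalSphere f x) (surfaceMeasure d) :=
  (continuous_evalSphere f).integrable_of_hasCompactSupport (HasCompactSupport.of_compactSpace _)

/-- The deviation of a polynomial function on the sphere from its mean. -/
noncomputable def centered (d : ℕ) : MvPolynomial (Fin d) ℝ →ₗ[ℝ] UnitSphere d → ℝ where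
  toFun f x := evalSphere f x - sphereMean f
  map_add' f g := by
    ext x
    have h : sphereMean (f + g) = sphereMean f + sphereMean g := by
      have := integral_add (integrable_evalSphere f) (integrable_evalSphere g)
      simp only [sphereMean, ← mul_add, ← this]
      simp [evalSphere]
    simp only [h, Pi.add_apply]
    simp only [evalSphere, map_add]
    ring
  map_smul' a f := by
    ext x
    have h : sphereMean (a • f) = a * sphereMean f := by
      simp only [sphereMean, evalSphere, MvPolynomial.smul_eval, integral_const_mul]
      ring
    simp only [h, Pi.smul_apply, smul_eq_mul, RingHom.id_apply]
    simp only [evalSphere, MvPolynomial.smul_eval]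
    ring

theorem centered_apply {d : ℕ} (f : MvPolynomial (Fin d) ℝ) (x : UnitSphere d) :
    centered d f x = evalSphere f x - sphereMean f := rfl

theorem integral_centered {d : ℕ} [Nonempty (UnitSphere d)] (f : MvPolynomial (Fin d) ℝ) :
    ∫ x, centered d f x ∂(surfaceMeasure d) = 0 := by
  have hpos : (surfaceMeasure d).real Set.univ ≠ 0 :=
    (measureReal_ne_zero_iff (measure_ne_top _ _)).2
      (isOpen_univ.measure_ne_zero _ Set.univ_nonempty)
  simp only [centered_apply]
  rw [integral_sub (integrable_evalSphere f) (integrable_const _), integral_const, smul_eq_mul,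
    sphereMean, mul_inv_cancel_left₀ hpos, sub_self]

theorem continuous_centered {d : ℕ} (f : MvPolynomial (Fin d) ℝ) : Continuous (centered d f) :=
  (continuous_evalSphere f).sub continuous_const

theorem centered_eq_zero_of_nonpos {d : ℕ} [Nonempty (UnitSphere d)]
    {f : MvPolynomial (Fin d) ℝ} (h : ∀ x, centered d f x ≤ 0) : centered d f = 0 := by
  have hc := continuous_centered f
  have hi : Integrable (centered d f) (surfaceMeasure d) :=
    hc.integrable_of_hasCompactSupport (HasCompactSupport.of_compactSpace _)
  have h0 : ∫ x, -centered d f x ∂(surfaceMeasure d) = 0 := by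
    rw [integral_neg, integral_centered, neg_zero]
  rw [integral_eq_zero_iff_of_nonneg (fun x => neg_nonneg.2 (h x)) hi.neg] at h0
  have := (Continuous.ae_eq_iff_eq (surfaceMeasure d) hc.neg continuous_const).1 h0
  ext x
  exact neg_eq_zero.1 (congrFun this x)

theorem isSphericalDesign_of_sum_centered_eq_zero {d w t : ℕ} {X : Finset (UnitSphere d)}
    (hX : X.Nonempty) (h : ∀ f ∈ designSpace w t d, ∑ x ∈ X, centered d f x = 0) :
    IsSphericalDesign w t X := by
  refine ⟨hX, fun f hf => ?_⟩
  have := h f hf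
  simp only [centered_apply, Finset.sum_sub_distrib, Finset.sum_const, nsmul_eq_mul,
    sub_eq_zero] at this
  have hcard : (X.card : ℝ) ≠ 0 := Nat.cast_ne_zero.2 hX.card_pos.ne'
  rw [this, inv_mul_cancel_left₀ hcard]
  rfl

/-! ### Dimension at least two -/

theorem exists_isSphericalDesign_of_two_le (w t : ℕ) {d : ℕ} (hd : 2 ≤ d) :
    ∃ X : Finset (UnitSphere d), IsSphericalDesign w t X := by
  have hrank : 1 < Module.rank ℝ (EuclideanSpace ℝ (Fin d)) := by
    rw [← Module.finrank_eq_rank, finrank_euclideanSpace_fin]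
    exact_mod_cast hd
  have := perfectSpace_sphere hrank
  have : Nontrivial (EuclideanSpace ℝ (Fin d)) := 
    rank_pos_iff_nontrivial.1 (zero_lt_one.trans hrank)
  have : Nonempty (UnitSphere d) := (NormedSpace.sphere_nonempty.2 zero_le_one).to_subtype
  have := finiteDimensional_designSpace w t d
  -- The basis is taken among functions on the sphere, not polynomials: a nonzero polynomial may
  -- have zero centered restriction, which would break `hsep`.
  let W := (designSpace w t d).map (centered d)
  let b := Module.finBasis ℝ W
  have hb : ∀ i, ∃ q ∈ designSpace w t d, centered d q = b i := fun i =>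
    Submodule.mem_map.1 (b i).2
  choose q hq hqb using hb
  let F : EuclideanSpace ℝ (Fin d) → Fin (Module.finrank ℝ W) → ℝ := fun x i =>
    MvPolynomial.eval (fun j => x j) (q i) - sphereMean (q i)
  have hF : ContDiff ℝ 1 F := contDiff_pi.2 fun i => (contDiff_eval (q i)).sub contDiff_const
  have hFc : ∀ (x : UnitSphere d) i, F x i = (b i : UnitSphere d → ℝ) x := fun x i => by
    rw [← hqb]; rfl
  have hsep : ∀ l : (Fin (Module.finrank ℝ W) → ℝ) →L[ℝ] ℝ,
      (∀ x : UnitSphere d, l (F x) ≤ 0) → l = 0 := by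
    intro l hl
    set c : Fin (Module.finrank ℝ W) → ℝ := fun i => l (Pi.single i 1) with hc
    have hlc : ∀ v, l v = ∑ i, c i * v i := fun v => by
      conv_lhs => rw [pi_eq_sum_univ' v]
      simp [hc, map_sum, mul_comm]
    have hcent : centered d (∑ i, c i • q i) = ∑ i, c i • (b i : UnitSphere d → ℝ) := by
      simp [map_sum, hqb]
    have hz : centered d (∑ i, c i • q i) = 0 := by
      refine centered_eq_zero_of_nonpos fun x => ?_
      have := hl x
      rw [hlc] at this
      rw [hcent]
      simpa [hFc] using this
    have hzb : ∑ i, c i • b i = 0 := Subtype.ext (by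
      rw [hcent] at hz
      simpa using hz)
    have hc0 := Fintype.linearIndependent_iff.1 b.linearIndependent c hzb
    ext v
    simp [hlc, hc0]
  obtain ⟨X, hX, hsum⟩ := exists_finset_sphere_sum_eq_zero hF hsep
  refine ⟨X, isSphericalDesign_of_sum_centered_eq_zero hX fun f hf => ?_⟩
  have hbX : ∀ i, ∑ x ∈ X, (b i : UnitSphere d → ℝ) x = 0 := fun i => by
    have := congrFun hsum i
    simpa [Finset.sum_apply, hFc] using this
  let v : W := ⟨centered d f, Submodule.mem_map_of_mem hf⟩
  have hv : ∀ x, centered d f x = ∑ i, b.repr v i * (b i : UnitSphere d → ℝ) x := fun x => by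
    have h : ((∑ i, b.repr v i • b i : W) : UnitSphere d → ℝ) x = centered d f x := by
      rw [b.sum_repr]
    simp only [Submodule.coe_sum, Finset.sum_apply, SetLike.val_smul, Pi.smul_apply,
      smul_eq_mul] at h
    exact h.symm
  simp only [hv]
  rw [Finset.sum_comm]
  simp [← Finset.mul_sum, hbX]

/-! ### Dimension one: two points of equal mass -/

theorem surfaceMeasure_singleton_neg {d : ℕ} (x : UnitSphere d) :
    surfaceMeasure d {-x} = surfaceMeasure d {x} := by
  rw [surfaceMeasure, Measure.toSphere_apply' _ (measurableSet_singleton _),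
    Measure.toSphere_apply' _ (measurableSet_singleton _)]
  congr 1
  rw [← Measure.measure_neg]
  congr 1
  ext y
  simp [neg_eq_iff_eq_neg]

theorem exists_isSphericalDesign_one (w t : ℕ) :
    ∃ X : Finset (UnitSphere 1), IsSphericalDesign w t X := by
  classical
  let e : UnitSphere 1 := ⟨EuclideanSpace.single 0 1, by simp⟩
  have huniv : ∀ x : UnitSphere 1, x = e ∨ x = -e := by
    intro x
    have hx : ‖(x : EuclideanSpace ℝ (Fin 1))‖ = 1 := by simp
    rw [EuclideanSpace.norm_eq] at hx
    simp only [Finset.univ_unique, Fin.default_eq_zero, Finset.sum_singleton, Real.sqrt_sq_eq_abs,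
      Real.norm_eq_abs, abs_abs] at hx
    rcases eq_or_eq_neg_of_abs_eq hx with h | h
    · left; ext i; fin_cases i; simpa [e] using h
    · right; ext i; fin_cases i; simpa [e] using h
  have hne : e ≠ -e := ne_neg_of_mem_unit_sphere ℝ e
  let _ : Fintype (UnitSphere 1) := ⟨{e, -e}, fun x => by simpa using huniv x⟩
  have : Nonempty (UnitSphere 1) := ⟨e⟩
  have hm : (surfaceMeasure 1).real {e} ≠ 0 := by
    intro h0
    have h0' : (surfaceMeasure 1) {e} = 0 := (measureReal_eq_zero_iff (measure_ne_top _ _)).1 h0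
    have hU : (Set.univ : Set (UnitSphere 1)) = {e} ∪ {-e} := by
      ext x; simpa [or_comm] using huniv x
    have : (surfaceMeasure 1) Set.univ = 0 := by
      rw [hU]
      exact measure_union_null h0' ((surfaceMeasure_singleton_neg e).trans h0')
    exact isOpen_univ.measure_ne_zero _ Set.univ_nonempty this
  have hpair : ∀ g : UnitSphere 1 → ℝ, ∑ x, g x = g e + g (-e) := fun g =>
    Finset.sum_pair hne
  refine ⟨Finset.univ, isSphericalDesign_of_sum_centered_eq_zero Finset.univ_nonempty
    fun f _ => ?_⟩
  have hint := integral_centered f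
  rw [integral_fintype ((continuous_centered f).integrable_of_hasCompactSupport
    (HasCompactSupport.of_compactSpace _)), hpair] at hint
  have hneg : (surfaceMeasure 1).real {-e} = (surfaceMeasure 1).real {e} := by
    rw [measureReal_def, surfaceMeasure_singleton_neg, measureReal_def]
  rw [hneg, ← smul_add] at hint
  rw [hpair]
  exact (smul_eq_zero.1 hint).resolve_left hm

theorem mainTheorem10 (w t d : ℕ) (hw : 0 < w) (ht : 0 < t) (hd : 0 < d) :
    ∃ X : Finset (UnitSphere d), IsSphericalDesign w t X := by
  rcases Nat.lt_or_ge d 2 with h | h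
  · obtain rfl : d = 1 := by omega
    exact exists_isSphericalDesign_one w t
  · exact exists_isSphericalDesign_of_two_le w t h
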